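/- Let $Q$ be a cyclic quadrilateral in the hyperbolic plane of curvature $-1$, that is, a (nondegenerate) convex quadrilateral whose four vertices lie on a circle, on a horocycle, or on one branch of an equidistant curve. Let $a,b,c,d$ be its consecutive side lengths, $s=\frac{a+b+c+d}{2}$ its semiperimeter, and $S$ its area. Then $$\sin^2\frac{S}{2}<\frac{\sinh(s-a)\,\sinh(s-b)\,\sinh(s-c)\,\sinh(s-d)}{4\cosh^2\frac{a}{2}\,\cosh^2\frac{b}{2}\,\cosh^2\frac{c}{2}\,\cosh^2\frac{d}{2}}$$ and $$\tan^2\frac{S}{4}>\tanh\frac{s-a}{2}\,\tanh\frac{s-b}{2}\,\tanh\frac{s-c}{2}\,\tanh\frac{s-d}{2}.$$ -/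

import Mathlib

open MeasureTheory
open scoped UpperHalfPlane

/-!
The hyperbolic plane of curvature `-1` is Mathlib's upper half-plane `ℍ`, with its Poincaré
distance `dist` and its area measure `volume`, which is `dx dy / y ^ 2`.
-/

noncomputable section

namespace HypPlane

/-- The geodesics of the upper half-plane are its vertical half-lines and its semicircles centred
on the real axis, that is, the sets `α * |u|² + β * re u + γ = 0`. For `P ≠ Q` the expression
below vanishes exactly for `U` on the geodesic line through `P` and `Q`, and its sign tells the
two sides of that line apart. It is the determinant of the three rows
`(1, re, |·|²)` at `P`, `Q`, `U`. -/
def side (P Q U : ℍ) : ℝ :=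
  (Q.re - P.re) * (Complex.normSq U - Complex.normSq P) -
    (U.re - P.re) * (Complex.normSq Q - Complex.normSq P)

/-- The geodesic line through two distinct points. -/
def line (P Q : ℍ) : Set ℍ := {U | side P Q U = 0}

/-- `R` and `R'` lie off the line `PQ` and strictly on the same side of it. -/
def SameSide (P Q R R' : ℍ) : Prop := 0 < side P Q R * side P Q R'

/-- The closed half-plane that is bounded by the line `PQ` and contains the point `R`
(for `R` off that line). -/
def halfPlane (P Q R : ℍ) : Set ℍ := {U | 0 ≤ side P Q R * side P Q U}

/-- `A`, `B`, `C`, `D` are, in this cyclic order, the vertices of a convex (nondegenerate)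
quadrilateral: for each of the sides `AB`, `BC`, `CD`, `DA`, the other two vertices lie strictly
on the same side of the line that contains it. -/
structure IsConvexQuad (A B C D : ℍ) : Prop where
  sideAB : SameSide A B C D
  sideBC : SameSide B C D A
  sideCD : SameSide C D A B
  sideDA : SameSide D A B C

/-- The convex quadrilateral with consecutive vertices `A`, `B`, `C`, `D`, as the intersection of
the four closed half-planes which contain it and are bounded by the lines of its sides. -/
def quad (A B C D : ℍ) : Set ℍ :=
  halfPlane A B C ∩ halfPlane B C D ∩ halfPlane C D A ∩ halfPlane D A B

/-- Hyperbolic circles of positive radius. -/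
def IsCircle (Γ : Set ℍ) : Prop := ∃ (O : ℍ) (r : ℝ), 0 < r ∧ Γ = Metric.sphere O r

/-- Horocycles: the horizontal lines (centred at `∞`), and the Euclidean circles, of diameter `k`,
that are tangent to the real axis at a point `x` (centred at `x`, the point `x` removed). -/
def IsHorocycle (Γ : Set ℍ) : Prop :=
  (∃ h : ℝ, 0 < h ∧ Γ = {U : ℍ | U.im = h}) ∨
    ∃ x k : ℝ, 0 < k ∧ Γ = {U : ℍ | (U.re - x) ^ 2 + U.im ^ 2 = k * U.im}

/-- One branch of an equidistant curve: the points at a fixed distance `r > 0` from a geodesic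
line that lie on one given side of it. (Exchanging `P` and `Q` gives the other side.) -/
def IsEquidistantBranch (Γ : Set ℍ) : Prop :=
  ∃ (P Q : ℍ) (r : ℝ), P ≠ Q ∧ 0 < r ∧
    Γ = {U : ℍ | Metric.infDist U (line P Q) = r ∧ 0 < side P Q U}

/-- `A`, `B`, `C`, `D` are the consecutive vertices of a cyclic quadrilateral: a convex one that is
inscribed in a circle, a horocycle or one branch of an equidistant curve. -/
def IsCyclicQuad (A B C D : ℍ) : Prop :=
  IsConvexQuad A B C D ∧
    ∃ Γ : Set ℍ, (IsCircle Γ ∨ IsHorocycle Γ ∨ IsEquidistantBranch Γ) ∧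
      A ∈ Γ ∧ B ∈ Γ ∧ C ∈ Γ ∧ D ∈ Γ

/-- The area of the convex quadrilateral with consecutive vertices `A`, `B`, `C`, `D`. -/
def area (A B C D : ℍ) : ℝ := (volume : Measure ℍ).real (quad A B C D)

end HypPlane

end

/-!
The key is a formula for `cos (S / 2)`. By Green's theorem the area `S` of a polygon, positively
oriented, is the sum over its sides of `∫ dx / y`; along the geodesic from `P` to `Q` this integral
is `2 arctan ((x_Q - x_P) / (y_P + y_Q))`, and `(y_P + y_Q, x_Q - x_P)` is a vector of length
`2 √(y_P y_Q) cosh (PQ / 2)`. For a convex quadrilateral with sides `a, b, c, d` and diagonals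
`e, f`, the addition theorem turns the sum of four arctangents into

`cos (S / 2) ∏ cosh (a / 2) = 1 + ½ ∑ sinh² (a / 2) + ½ (α² γ² + β² δ² - ε² φ²)`,

where `α, …, φ` are the `sinh` of half the sides and diagonals (`cos_sum_sideAngle`, which is a
polynomial identity for any four points). The integral computation is made only when one diagonal
lies on the imaginary axis (`IsConvexQuad.area_of_normal`); an isometry and a renaming of the
vertices reduce the general case to this one (`IsConvexQuad.hasAreaFormula`).

Circles, horocycles and equidistant curves all lie on Euclidean circles or lines
(`IsCyclicQuad.ptolemyEq`), and `sinh (PQ / 2)` is the Euclidean distance divided by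
`2 √(y_P y_Q)`. So Ptolemy's theorem gives `ε φ = α γ + β δ`, and the last term of the formula
becomes `-α β γ δ`. With `N = ∏ sinh ((s - a) / 2)`, `M = ∏ cosh ((s - a) / 2)`,
`σ = ∏ sinh (a / 2)` and `K = ∏ cosh (a / 2)`, elementary identities rewrite the result as
`(1 - cos (S / 2)) K = 2 N` and `(1 + cos (S / 2)) K = 2 (M - σ)`, hence

`sin² (S / 2) = 4 N (M - σ) / K²`, `tan² (S / 4) = N / (M - σ)`.

The right-hand sides of the two inequalities are `4 N M / K²` and `N / M`, so that they follow from
`0 < N` (as `0 < S / 2 < 2π`) and `0 < σ < M` (`brahmagupta_inequalities`).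
-/

namespace HypPlane

open UpperHalfPlane

/-! ### Orientation predicates and isometries -/

lemma side_eq (P Q U : ℍ) : side P Q U =
    (Q.re - P.re) * ((U.re ^ 2 + U.im ^ 2) - (P.re ^ 2 + P.im ^ 2)) -
      (U.re - P.re) * ((Q.re ^ 2 + Q.im ^ 2) - (P.re ^ 2 + P.im ^ 2)) := by
  simp only [side, Complex.normSq_apply, coe_re, coe_im]
  ring

lemma side_cycle (P Q U : ℍ) : side Q U P = side P Q U := by
  simp only [side_eq]; ring

lemma side_swap (P Q U : ℍ) : side Q P U = -side P Q U := by
  simp only [side_eq]; ring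

lemma sameSide_swap {P Q R R' : ℍ} : SameSide Q P R R' ↔ SameSide P Q R R' := by
  simp only [SameSide, side_swap P Q, neg_mul_neg]

lemma sameSide_comm {P Q R R' : ℍ} : SameSide P Q R R' ↔ SameSide P Q R' R := by
  simp only [SameSide, mul_comm]

lemma IsConvexQuad.rotate {A B C D : ℍ} (h : IsConvexQuad A B C D) : IsConvexQuad B C D A :=
  ⟨h.sideBC, h.sideCD, h.sideDA, h.sideAB⟩

lemma IsConvexQuad.reverse {A B C D : ℍ} (h : IsConvexQuad A B C D) : IsConvexQuad A D C B :=
  ⟨sameSide_swap.1 (sameSide_comm.1 h.sideDA), sameSide_swap.1 (sameSide_comm.1 h.sideCD),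
    sameSide_swap.1 (sameSide_comm.1 h.sideBC), sameSide_swap.1 (sameSide_comm.1 h.sideAB)⟩

/-- The triangles `ABC` and `CDA` cut off by a diagonal have the same orientation. -/
lemma IsConvexQuad.side_mul_side_pos {A B C D : ℍ} (h : IsConvexQuad A B C D) :
    0 < side A B C * side C D A := by
  have h1 := h.sideBC
  have h2 := h.sideCD
  unfold SameSide at h1 h2
  rw [side_cycle A B C] at h1
  rw [side_cycle B C D] at h2
  have h3 : side B C D ≠ 0 := by rintro h; simp [h] at h1
  have h4 := mul_pos h1 h2
  have h5 : 0 < side B C D ^ 2 := by positivity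
  refine pos_of_mul_pos_right (a := side B C D ^ 2) ?_ h5.le
  linarith

lemma IsConvexQuad.ne {A B C D : ℍ} (h : IsConvexQuad A B C D) : A ≠ B := by
  rintro rfl
  have := h.sideAB
  simp [SameSide, side_eq] at this

lemma halfPlane_swap (P Q R : ℍ) : halfPlane Q P R = halfPlane P Q R := by
  ext U; simp only [halfPlane, side_swap P Q, neg_mul_neg]

/-- A half-plane does not depend on the point that designates it. -/
lemma halfPlane_congr {P Q R R' : ℍ} (h : SameSide P Q R R') :
    halfPlane P Q R = halfPlane P Q R' := by
  ext U
  simp only [halfPlane, Set.mem_ofPred_eq]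
  rcases mul_pos_iff.1 h with ⟨h1, h2⟩ | ⟨h1, h2⟩
  · rw [mul_nonneg_iff_of_pos_left h1, mul_nonneg_iff_of_pos_left h2]
  · rw [← neg_mul_neg, ← neg_mul_neg (side P Q R'), mul_nonneg_iff_of_pos_left (neg_pos.2 h1),
      mul_nonneg_iff_of_pos_left (neg_pos.2 h2)]

lemma area_rotate (A B C D : ℍ) : area B C D A = area A B C D := by
  unfold area quad
  congr 1
  ext U; simp only [Set.mem_inter_iff]; tauto

lemma IsConvexQuad.area_reverse {A B C D : ℍ} (h : IsConvexQuad A B C D) :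
    area A D C B = area A B C D := by
  unfold area quad
  rw [halfPlane_swap D A, halfPlane_swap C D, halfPlane_swap B C, halfPlane_swap A B,
    halfPlane_congr h.sideAB, halfPlane_congr h.sideBC, halfPlane_congr h.sideCD,
    halfPlane_congr h.sideDA]
  congr 1
  ext U; simp only [Set.mem_inter_iff]; tauto

/-- The squared modulus of the denominator `c z + d` of the Möbius transformation `g`. -/
noncomputable def denomSq (g : Matrix.SpecialLinearGroup (Fin 2) ℝ) (U : ℍ) : ℝ :=
  (g 1 0 * U.re + g 1 1) ^ 2 + (g 1 0 * U.im) ^ 2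

lemma denomSq_pos (g : Matrix.SpecialLinearGroup (Fin 2) ℝ) (U : ℍ) : 0 < denomSq g U := by
  have hd := g.det_coe
  rw [Matrix.det_fin_two] at hd
  unfold denomSq
  by_cases h : g 1 0 = 0
  · have : g 1 1 ≠ 0 := by rintro h'; simp [h, h'] at hd
    have : 0 < g 1 1 ^ 2 := by positivity
    simpa [h] using this
  · have := U.im_pos
    positivity

lemma re_smul_eq (g : Matrix.SpecialLinearGroup (Fin 2) ℝ) (U : ℍ) :
    (g • U).re = (g 0 0 * g 1 0 * (U.re ^ 2 + U.im ^ 2) +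
      (g 0 0 * g 1 1 + g 0 1 * g 1 0) * U.re + g 0 1 * g 1 1) / denomSq g U := by
  rw [← coe_re, coe_specialLinearGroup_apply, Complex.div_re, ← add_div]
  simp only [Complex.normSq_apply, Algebra.algebraMap_self, RingHom.id_apply,
    Complex.add_re, Complex.mul_re, Complex.ofReal_re, Complex.ofReal_im, coe_re, coe_im,
    Complex.add_im, Complex.mul_im]
  simp only [denomSq]
  congr 1 <;> ring

lemma re_sq_add_im_sq_smul (g : Matrix.SpecialLinearGroup (Fin 2) ℝ) (U : ℍ) :
    (g • U).re ^ 2 + (g • U).im ^ 2 = (g 0 0 ^ 2 * (U.re ^ 2 + U.im ^ 2) +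
      2 * g 0 0 * g 0 1 * U.re + g 0 1 ^ 2) / denomSq g U := by
  have e : (g • U).re ^ 2 + (g • U).im ^ 2 = Complex.normSq (g • U : ℍ) := by
    simp only [Complex.normSq_apply, coe_re, coe_im]; ring
  rw [e, coe_specialLinearGroup_apply, Complex.normSq_div]
  simp only [Complex.normSq_apply, Algebra.algebraMap_self, RingHom.id_apply,
    Complex.add_re, Complex.mul_re, Complex.ofReal_re, Complex.ofReal_im, coe_re, coe_im,
    Complex.add_im, Complex.mul_im]
  simp only [denomSq]
  congr 1 <;> ring

/-- The action on the rows `(1, re, |·|²)` is, up to the factor `denomSq`, linear, and its matrix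
(a symmetric square) has determinant `1`. -/
lemma side_smul (g : Matrix.SpecialLinearGroup (Fin 2) ℝ) (P Q U : ℍ) :
    side (g • P) (g • Q) (g • U) =
      side P Q U / (denomSq g P * denomSq g Q * denomSq g U) := by
  have hP := (denomSq_pos g P).ne'
  have hQ := (denomSq_pos g Q).ne'
  have hU := (denomSq_pos g U).ne'
  have hd := g.det_coe
  rw [Matrix.det_fin_two] at hd
  have key : ∀ a b c d x y z x' y' z' n n' n'' : ℝ, a * d - b * c = 1 →
      n = c ^ 2 * x' + 2 * c * d * x + d ^ 2 → n' = c ^ 2 * y' + 2 * c * d * y + d ^ 2 →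
      n'' = c ^ 2 * z' + 2 * c * d * z + d ^ 2 → n ≠ 0 → n' ≠ 0 → n'' ≠ 0 →
      ((a * c * y' + (a * d + b * c) * y + b * d) / n' -
        (a * c * x' + (a * d + b * c) * x + b * d) / n) *
      ((a ^ 2 * z' + 2 * a * b * z + b ^ 2) / n'' - (a ^ 2 * x' + 2 * a * b * x + b ^ 2) / n) -
      ((a * c * z' + (a * d + b * c) * z + b * d) / n'' -
        (a * c * x' + (a * d + b * c) * x + b * d) / n) *
      ((a ^ 2 * y' + 2 * a * b * y + b ^ 2) / n' - (a ^ 2 * x' + 2 * a * b * x + b ^ 2) / n) =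
      ((y - x) * (z' - x') - (z - x) * (y' - x')) / (n * n' * n'') := by
    intro a b c d x y z x' y' z' n n' n'' h hn hn' hn'' h0 h0' h0''
    have e : ((y - x) * (z' - x') - (z - x) * (y' - x')) =
      (a * d - b * c) ^ 3 * ((y - x) * (z' - x') - (z - x) * (y' - x')) := by rw [h]; ring
    rw [e]
    field_simp
    rw [hn, hn', hn'']
    ring
  rw [side_eq, side_eq]
  simp only [re_sq_add_im_sq_smul]
  simp only [re_smul_eq]
  refine key _ _ _ _ _ _ _ _ _ _ _ _ _ hd ?_ ?_ ?_ hP hQ hU <;> simp only [denomSq] <;> ring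

lemma side_smul_pos_iff (g : Matrix.SpecialLinearGroup (Fin 2) ℝ) (P Q U : ℍ) :
    0 < side (g • P) (g • Q) (g • U) ↔ 0 < side P Q U := by
  have hP := denomSq_pos g P
  have hQ := denomSq_pos g Q
  have hU := denomSq_pos g U
  rw [side_smul, div_pos_iff_of_pos_right (by positivity)]

lemma sameSide_smul (g : Matrix.SpecialLinearGroup (Fin 2) ℝ) (P Q R R' : ℍ) :
    SameSide (g • P) (g • Q) (g • R) (g • R') ↔ SameSide P Q R R' := by
  have hP := denomSq_pos g P
  have hQ := denomSq_pos g Q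
  have hR := denomSq_pos g R
  have hR' := denomSq_pos g R'
  simp only [SameSide, side_smul, div_mul_div_comm]
  rw [div_pos_iff_of_pos_right (by positivity)]

lemma mem_halfPlane_smul (g : Matrix.SpecialLinearGroup (Fin 2) ℝ) (P Q R U : ℍ) :
    g • U ∈ halfPlane (g • P) (g • Q) (g • R) ↔ U ∈ halfPlane P Q R := by
  have hP := denomSq_pos g P
  have hQ := denomSq_pos g Q
  have hR := denomSq_pos g R
  have hU := denomSq_pos g U
  simp only [halfPlane, Set.mem_ofPred_eq, side_smul, div_mul_div_comm]
  rw [le_div_iff₀ (by positivity), zero_mul]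

lemma IsConvexQuad.smul {A B C D : ℍ} (h : IsConvexQuad A B C D)
    (g : Matrix.SpecialLinearGroup (Fin 2) ℝ) :
    IsConvexQuad (g • A) (g • B) (g • C) (g • D) :=
  ⟨(sameSide_smul ..).2 h.sideAB, (sameSide_smul ..).2 h.sideBC, (sameSide_smul ..).2 h.sideCD,
    (sameSide_smul ..).2 h.sideDA⟩

open scoped Pointwise in
lemma area_smul (g : Matrix.SpecialLinearGroup (Fin 2) ℝ) (A B C D : ℍ) :
    area (g • A) (g • B) (g • C) (g • D) = area A B C D := by
  have e : quad (g • A) (g • B) (g • C) (g • D) =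
      (g : GL (Fin 2) ℝ) • quad A B C D := by
    ext U
    rw [Set.mem_smul_set_iff_inv_smul_mem]
    obtain ⟨V, rfl⟩ : ∃ V : ℍ, g • V = U := ⟨g⁻¹ • U, smul_inv_smul g U⟩
    have : ((g : GL (Fin 2) ℝ)⁻¹ • g • V) = V :=
      inv_smul_smul (g : GL (Fin 2) ℝ) V
    rw [this]
    simp only [quad, Set.mem_inter_iff, mem_halfPlane_smul]
  rw [area, area, e, measureReal_def, measure_smul, measureReal_def]

/-- Any two points can be moved to the imaginary axis. -/
lemma exists_smul_re_eq_zero (P Q : ℍ) :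
    ∃ g : Matrix.SpecialLinearGroup (Fin 2) ℝ, (g • P).re = 0 ∧ (g • Q).re = 0 := by
  obtain ⟨h, hh⟩ := MulAction.exists_smul_eq (Matrix.SpecialLinearGroup (Fin 2) ℝ) P I
  -- The rotation about `I` through the angle `2 θ` that takes `h • Q` to the imaginary axis.
  set z := h • Q
  set w : ℂ := ⟨(z.re ^ 2 + z.im ^ 2 - 1) / 2, z.re⟩ with hw
  set θ := w.arg / 2 with hθ
  have hc : ‖w‖ * Real.cos (2 * θ) = (z.re ^ 2 + z.im ^ 2 - 1) / 2 := by
    rw [show 2 * θ = w.arg by rw [hθ]; ring, Complex.norm_mul_cos_arg]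
  have hs : ‖w‖ * Real.sin (2 * θ) = z.re := by
    rw [show 2 * θ = w.arg by rw [hθ]; ring, Complex.norm_mul_sin_arg]
  rw [Real.cos_two_mul'] at hc
  rw [Real.sin_two_mul] at hs
  have h1 := Real.sin_sq_add_cos_sq θ
  let k : Matrix.SpecialLinearGroup (Fin 2) ℝ :=
    ⟨!![Real.cos θ, Real.sin θ; -Real.sin θ, Real.cos θ], by
      rw [Matrix.det_fin_two_of]; linear_combination h1⟩
  have hk : ∀ U : ℍ, (k • U).re = (Real.cos θ * -Real.sin θ * (U.re ^ 2 + U.im ^ 2) +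
      (Real.cos θ * Real.cos θ + Real.sin θ * -Real.sin θ) * U.re +
        Real.sin θ * Real.cos θ) / denomSq k U := fun U => re_smul_eq k U
  refine ⟨k * h, ?_, ?_⟩
  · rw [mul_smul, hh, hk]
    simp
    left; ring
  · rw [mul_smul, hk, div_eq_zero_iff]
    left
    change Real.cos θ * -Real.sin θ * (z.re ^ 2 + z.im ^ 2) +
      (Real.cos θ * Real.cos θ + Real.sin θ * -Real.sin θ) * z.re +
        Real.sin θ * Real.cos θ = 0
    linear_combination (2 * Real.cos θ * Real.sin θ) * hc -
      (Real.cos θ ^ 2 - Real.sin θ ^ 2) * hs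

/-! ### Ptolemy's theorem -/

/-- The chord lengths of four points satisfy Ptolemy's equality once the cross ratio is real (`h₀`)
and positive (`h₁`): the products `(A - B) (C - D)` and `(B - C) (A - D)`, whose sum is
`(A - C) (B - D)`, then have the same argument. -/
lemma norm_mul_norm_eq_of_cross_ratio {A B C D : ℂ}
    (h₀ : ((A - B) * (C - D) * starRingEnd ℂ ((B - C) * (A - D))).im = 0)
    (h₁ : 0 < ((A - B) * (C - D) * starRingEnd ℂ ((B - C) * (A - D))).re) :
    ‖A - C‖ * ‖B - D‖ = ‖A - B‖ * ‖C - D‖ + ‖B - C‖ * ‖A - D‖ := by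
  simp only [← norm_mul]
  set u := (A - B) * (C - D)
  set v := (B - C) * (A - D)
  have e : (A - C) * (B - D) = u + v := by simp only [u, v]; ring
  set r := (u * starRingEnd ℂ v).re
  have huv : u * starRingEnd ℂ v = r := Complex.ext rfl (by simpa using h₀)
  have hv : v ≠ 0 := by rintro hv; simp [r, hv] at h₁
  have hn : 0 < Complex.normSq v := Complex.normSq_pos.2 hv
  have hu : u = (r / Complex.normSq v) • v := by
    have h2 : (Complex.normSq v : ℂ) ≠ 0 := by exact_mod_cast hn.ne'
    rw [Complex.real_smul, Complex.ofReal_div, div_mul_eq_mul_div, eq_div_iff h2, ← huv,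
      ← Complex.mul_conj]
    ring
  rw [e]
  refine SameRay.norm_add ?_
  rw [hu]
  exact SameRay.sameRay_pos_smul_left v (by positivity)

/-- Ptolemy's theorem for a convex quadrilateral inscribed in a Euclidean circle or line
`ε |z|² = α x + β y + γ`. If `β = 0 ≠ ε`, the curve is a geodesic, and no such quadrilateral
exists. -/
lemma IsConvexQuad.ptolemy_of_circle {A B C D : ℍ} (h : IsConvexQuad A B C D) {ε α β γ : ℝ}
    (h₀ : ε ≠ 0 ∨ β ≠ 0)
    (hA : ε * (A.re ^ 2 + A.im ^ 2) = α * A.re + β * A.im + γ)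
    (hB : ε * (B.re ^ 2 + B.im ^ 2) = α * B.re + β * B.im + γ)
    (hC : ε * (C.re ^ 2 + C.im ^ 2) = α * C.re + β * C.im + γ)
    (hD : ε * (D.re ^ 2 + D.im ^ 2) = α * D.re + β * D.im + γ) :
    ‖(A - C : ℂ)‖ * ‖(B - D : ℂ)‖ =
      ‖(A - B : ℂ)‖ * ‖(C - D : ℂ)‖ + ‖(B - C : ℂ)‖ * ‖(A - D : ℂ)‖ := by
  have hs := h.side_mul_side_pos
  simp only [side_eq] at hs
  suffices H : ((A - B : ℂ) * (C - D) * starRingEnd ℂ ((B - C) * (A - D))).im = 0 ∧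
      0 < ((A - B : ℂ) * (C - D) * starRingEnd ℂ ((B - C) * (A - D))).re from
    norm_mul_norm_eq_of_cross_ratio H.1 H.2
  simp only [map_mul, map_sub, Complex.mul_re, Complex.mul_im, Complex.sub_re, Complex.sub_im,
    Complex.conj_re, Complex.conj_im, coe_re, coe_im]
  generalize A.re = a, A.im = a' at *
  generalize B.re = b, B.im = b' at *
  generalize C.re = c, C.im = c' at *
  generalize D.re = d, D.im = d' at *
  by_cases hε : ε = 0
  · subst hε
    have hβ : β ≠ 0 := by simpa using h₀
    have hl : ∀ x y : ℝ, 0 * (x ^ 2 + y ^ 2) = α * x + β * y + γ →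
        y = (-α / β) * x + (-γ / β) := by
      intro x y e
      field_simp
      linarith
    rw [hl _ _ hA, hl _ _ hB, hl _ _ hC, hl _ _ hD] at hs ⊢
    generalize -α / β = m at *
    generalize -γ / β = n at *
    constructor
    · ring
    · have e : 0 < (1 + m ^ 2) ^ 2 * (c - a) ^ 2 *
          ((a - b) * (b - c) * (c - d) * (a - d)) := by
        refine hs.trans_eq ?_
        ring
      have e2 : 0 < (a - b) * (b - c) * (c - d) * (a - d) :=
        pos_of_mul_pos_right e (by positivity)
      have e3 : 0 < (1 + m ^ 2) ^ 2 * ((a - b) * (b - c) * (c - d) * (a - d)) := by positivity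
      refine e3.trans_eq ?_
      ring
  · -- `X` and `Y` are the imaginary parts of the factors `(A - B) conj (B - C)` and
    -- `(C - D) conj (A - D)`, `X'` and `Y'` their real parts.
    set X := (a' - b') * (b - c) - (a - b) * (b' - c') with hX
    set Y := (c' - d') * (a - d) - (c - d) * (a' - d') with hY
    set X' := (a - b) * (b - c) + (a' - b') * (b' - c') with hX'
    set Y' := (c - d) * (a - d) + (c' - d') * (a' - d') with hY'
    have him : X' * Y + X * Y' = 0 := by
      refine mul_left_cancel₀ hε ?_
      simp only [hX, hY, hX', hY']
      linear_combination
        ((c-b)*(d'-b')-(d-b)*(c'-b')) * hA - ((c-a)*(d'-a')-(d-a)*(c'-a')) * hB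
        + ((b-a)*(d'-a')-(d-a)*(b'-a')) * hC - ((b-a)*(c'-a')-(c-a)*(b'-a')) * hD
    have hXY : X * Y < 0 := by
      have e : (-(β ^ 2)) * (X * Y) = ε ^ 2 * (((b - a) * (c ^ 2 + c' ^ 2 - (a ^ 2 + a' ^ 2)) -
          (c - a) * (b ^ 2 + b' ^ 2 - (a ^ 2 + a' ^ 2))) *
          ((d - c) * (a ^ 2 + a' ^ 2 - (c ^ 2 + c' ^ 2)) -
          (a - c) * (d ^ 2 + d' ^ 2 - (c ^ 2 + c' ^ 2)))) := by
        have e1 : ε * ((b - a) * (c ^ 2 + c' ^ 2 - (a ^ 2 + a' ^ 2)) -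
          (c - a) * (b ^ 2 + b' ^ 2 - (a ^ 2 + a' ^ 2))) = -β * X := by
          simp only [hX]
          linear_combination (b - a) * (hC - hA) - (c - a) * (hB - hA)
        have e2 : ε * ((d - c) * (a ^ 2 + a' ^ 2 - (c ^ 2 + c' ^ 2)) -
          (a - c) * (d ^ 2 + d' ^ 2 - (c ^ 2 + c' ^ 2))) = β * Y := by
          simp only [hY]
          linear_combination (d - c) * (hA - hC) - (a - c) * (hD - hC)
        linear_combination -e1 * (β * Y) - (ε * ((b - a) * (c ^ 2 + c' ^ 2 - (a ^ 2 + a' ^ 2)) -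
          (c - a) * (b ^ 2 + b' ^ 2 - (a ^ 2 + a' ^ 2)))) * e2
      have e3 : 0 < ε ^ 2 := by positivity
      have e4 : 0 < -(β ^ 2) * (X * Y) := e ▸ mul_pos e3 hs
      by_contra! hn
      have e5 := mul_nonneg (sq_nonneg β) hn
      rw [neg_mul] at e4
      exact absurd (neg_pos.1 e4) (not_lt.2 e5)
    constructor
    · linear_combination him
    · have hYne : Y ≠ 0 := by rintro h; simp [h] at hXY
      have e : 0 < Y ^ 2 * (X' * Y' - X * Y) := by
        have : Y ^ 2 * (X' * Y' - X * Y) = -(X * Y) * (Y' ^ 2 + Y ^ 2) := by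
          linear_combination Y * Y' * him
        rw [this]
        have : 0 < Y ^ 2 := by positivity
        have : 0 < -(X * Y) := by linarith
        positivity
      have := pos_of_mul_pos_right e (sq_nonneg _)
      refine this.trans_eq ?_
      simp only [hX, hY, hX', hY']
      ring

/-- Ptolemy's equality in its hyperbolic form: the product of the diagonals is the sum of the
products of opposite sides, each length `x` entering as `sinh (x / 2)`. -/
def PtolemyEq (A B C D : ℍ) : Prop :=
  Real.sinh (dist A C / 2) * Real.sinh (dist B D / 2) =
    Real.sinh (dist A B / 2) * Real.sinh (dist C D / 2) +
      Real.sinh (dist B C / 2) * Real.sinh (dist D A / 2)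

lemma ptolemyEq_of_norm {A B C D : ℍ}
    (h : ‖(A - C : ℂ)‖ * ‖(B - D : ℂ)‖ =
      ‖(A - B : ℂ)‖ * ‖(C - D : ℂ)‖ + ‖(B - C : ℂ)‖ * ‖(A - D : ℂ)‖) : PtolemyEq A B C D := by
  have hA := A.im_pos
  have hB := B.im_pos
  have hC := C.im_pos
  have hD := D.im_pos
  unfold PtolemyEq
  rw [dist_comm D A]
  simp only [sinh_half_dist, Complex.dist_eq, Real.sqrt_mul hA.le, Real.sqrt_mul hB.le,
    Real.sqrt_mul hC.le]
  field_simp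
  linear_combination h

lemma ptolemyEq_smul (g : Matrix.SpecialLinearGroup (Fin 2) ℝ) {A B C D : ℍ} :
    PtolemyEq (g • A) (g • B) (g • C) (g • D) ↔ PtolemyEq A B C D := by
  simp only [PtolemyEq, dist_smul]

lemma IsConvexQuad.ptolemyEq_of_sphere {A B C D : ℍ} (h : IsConvexQuad A B C D) {O : ℍ} {r : ℝ}
    (hA : A ∈ Metric.sphere O r) (hB : B ∈ Metric.sphere O r) (hC : C ∈ Metric.sphere O r)
    (hD : D ∈ Metric.sphere O r) : PtolemyEq A B C D := by
  have key : ∀ U ∈ Metric.sphere O r, 1 * (U.re ^ 2 + U.im ^ 2) =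
      (2 * O.re) * U.re + (2 * O.im * Real.cosh r) * U.im + -(O.re ^ 2 + O.im ^ 2) := by
    intro U hU
    have h1 := cosh_dist' U O
    rw [Metric.mem_sphere.1 hU] at h1
    have hO := O.im_pos
    have hU := U.im_pos
    field_simp at h1
    linear_combination -h1
  exact ptolemyEq_of_norm
    (h.ptolemy_of_circle (.inl one_ne_zero) (key _ hA) (key _ hB) (key _ hC) (key _ hD))

lemma IsConvexQuad.ptolemyEq_of_horocycle {A B C D : ℍ} (h : IsConvexQuad A B C D) {Γ : Set ℍ}
    (hΓ : IsHorocycle Γ) (hA : A ∈ Γ) (hB : B ∈ Γ) (hC : C ∈ Γ) (hD : D ∈ Γ) :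
    PtolemyEq A B C D := by
  rcases hΓ with ⟨k, -, rfl⟩ | ⟨x, k, -, rfl⟩
  · have key : ∀ U : ℍ, U.im = k → 0 * (U.re ^ 2 + U.im ^ 2) = 0 * U.re + 1 * U.im + -k := by
      intro U hU
      rw [hU]; ring
    exact ptolemyEq_of_norm
      (h.ptolemy_of_circle (.inr one_ne_zero) (key _ hA) (key _ hB) (key _ hC) (key _ hD))
  · have key : ∀ U : ℍ, (U.re - x) ^ 2 + U.im ^ 2 = k * U.im →
        1 * (U.re ^ 2 + U.im ^ 2) = (2 * x) * U.re + k * U.im + -x ^ 2 := by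
      intro U hU
      linear_combination hU
    exact ptolemyEq_of_norm
      (h.ptolemy_of_circle (.inl one_ne_zero) (key _ hA) (key _ hB) (key _ hC) (key _ hD))

lemma mem_line_of_re_eq_zero {P Q : ℍ} (hPQ : P ≠ Q) (hP : P.re = 0) (hQ : Q.re = 0) {U : ℍ} :
    U ∈ line P Q ↔ U.re = 0 := by
  have hne : Q.im ^ 2 - P.im ^ 2 ≠ 0 := by
    intro e
    have e1 : Q.im = P.im := by
      have := P.im_pos
      have := Q.im_pos
      nlinarith
    exact hPQ (UpperHalfPlane.ext_re_im (by rw [hP, hQ]) e1.symm)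
  simp [line, Set.mem_ofPred_eq, side_eq, hP, hQ, hne]

/-- The distance from the imaginary axis. The nearest point to `U` on it is `i |U|`. -/
lemma cosh_infDist_line {P Q : ℍ} (hPQ : P ≠ Q) (hP : P.re = 0) (hQ : Q.re = 0) (U : ℍ) :
    Real.cosh (Metric.infDist U (line P Q)) * U.im = √(U.re ^ 2 + U.im ^ 2) := by
  have hU := U.im_pos
  set ρ := √(U.re ^ 2 + U.im ^ 2) with hρ
  have hρ0 : 0 < ρ := Real.sqrt_pos.2 (by positivity)
  have hρ2 : ρ ^ 2 = U.re ^ 2 + U.im ^ 2 := Real.sq_sqrt (by positivity)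
  let V : ℍ := ⟨⟨0, ρ⟩, hρ0⟩
  have hVr : V.re = 0 := rfl
  have hVi : V.im = ρ := rfl
  have hV : V ∈ line P Q := (mem_line_of_re_eq_zero hPQ hP hQ).2 hVr
  have e : Metric.infDist U (line P Q) = dist U V := by
    refine le_antisymm (Metric.infDist_le_dist_of_mem hV) ((Metric.le_infDist ⟨V, hV⟩).2 ?_)
    intro W hW
    have hWr := (mem_line_of_re_eq_zero hPQ hP hQ).1 hW
    have hWi := W.im_pos
    rw [← abs_of_nonneg (dist_nonneg (x := U) (y := V)),
      ← abs_of_nonneg (dist_nonneg (x := U) (y := W)), ← Real.cosh_le_cosh, cosh_dist', cosh_dist',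
      hVr, hVi, hWr]
    rw [div_le_div_iff₀ (by positivity) (by positivity)]
    have : 0 ≤ U.im * ρ * (W.im - ρ) ^ 2 := by positivity
    linear_combination 2 * this + (2 * U.im * ρ - 2 * U.im * W.im) * hρ2
  rw [e, cosh_dist', hVr, hVi]
  field_simp
  linear_combination -hρ2

lemma line_smul (g : Matrix.SpecialLinearGroup (Fin 2) ℝ) (P Q : ℍ) :
    line (g • P) (g • Q) = (g • ·) '' line P Q := by
  ext U
  obtain ⟨V, rfl⟩ : ∃ V : ℍ, g • V = U := ⟨g⁻¹ • U, smul_inv_smul g U⟩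
  rw [(MulAction.injective g).mem_set_image]
  have hP := (denomSq_pos g P).ne'
  have hQ := (denomSq_pos g Q).ne'
  have hV := (denomSq_pos g V).ne'
  simp [line, Set.mem_ofPred_eq, side_smul, hP, hQ, hV]

lemma IsConvexQuad.ptolemyEq_of_equidistantBranch {A B C D : ℍ} (h : IsConvexQuad A B C D)
    {Γ : Set ℍ} (hΓ : IsEquidistantBranch Γ) (hA : A ∈ Γ) (hB : B ∈ Γ) (hC : C ∈ Γ) (hD : D ∈ Γ) :
    PtolemyEq A B C D := by
  obtain ⟨P, Q, r, hPQ, hr, rfl⟩ := hΓ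
  -- Once the axis is the imaginary axis, the branch lies on the Euclidean line
  -- `σ x = sinh r * y`, where `σ = ±1` depends on the side and is the same for all points.
  obtain ⟨g, hP, hQ⟩ := exists_smul_re_eq_zero P Q
  have hPQ' : g • P ≠ g • Q := fun e => hPQ (MulAction.injective g e)
  set δ := (g • Q).im ^ 2 - (g • P).im ^ 2 with hδ
  have key : ∃ σ : ℝ, ∀ U : ℍ, (Metric.infDist U (line P Q) = r ∧ 0 < side P Q U) →
      0 * ((g • U).re ^ 2 + (g • U).im ^ 2) = (-σ) * (g • U).re + Real.sinh r * (g • U).im + 0 := by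
    refine ⟨-SignType.sign δ, fun U ⟨h1, h2⟩ => ?_⟩
    have e1 := cosh_infDist_line hPQ' hP hQ (g • U)
    rw [line_smul, Metric.infDist_image (isometry_smul ℍ g), h1] at e1
    rw [← side_smul_pos_iff g, side_eq, hP, hQ] at h2
    have hU := (g • U).im_pos
    generalize (g • U).re = x at *
    generalize (g • U).im = y at *
    have e2 : (Real.cosh r * y) ^ 2 = x ^ 2 + y ^ 2 := by rw [e1, Real.sq_sqrt (by positivity)]
    have e3 : (Real.sinh r * y) ^ 2 = x ^ 2 := by
      rw [mul_pow, Real.cosh_sq] at e2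
      linear_combination e2
    have e4 : 0 < -x * δ := by
      refine h2.trans_eq ?_
      rw [hδ]; ring
    have e5 : 0 < Real.sinh r * y := mul_pos (Real.sinh_pos_iff.2 hr) hU
    rcases lt_trichotomy δ 0 with hd | hd | hd
    · have : 0 < x := by nlinarith
      have e6 : Real.sinh r * y = x := by
        rwa [sq_eq_sq₀ e5.le this.le] at e3
      simp [sign_neg hd]; linarith
    · simp [hd] at e4
    · have : 0 < -x := pos_of_mul_pos_left e4 hd.le
      have e6 : Real.sinh r * y = -x := by
        rwa [← neg_sq x, sq_eq_sq₀ e5.le this.le] at e3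
      simp [sign_pos hd]; linarith
  obtain ⟨σ, key⟩ := key
  rw [← ptolemyEq_smul g]
  exact ptolemyEq_of_norm ((h.smul g).ptolemy_of_circle (.inr (Real.sinh_pos_iff.2 hr).ne')
    (key _ hA) (key _ hB) (key _ hC) (key _ hD))

theorem IsCyclicQuad.ptolemyEq {A B C D : ℍ} (h : IsCyclicQuad A B C D) : PtolemyEq A B C D := by
  obtain ⟨h, Γ, ⟨O, r, -, rfl⟩ | hΓ | hΓ, hA, hB, hC, hD⟩ := h
  · exact h.ptolemyEq_of_sphere hA hB hC hD
  · exact h.ptolemyEq_of_horocycle hΓ hA hB hC hD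
  · exact h.ptolemyEq_of_equidistantBranch hΓ hA hB hC hD

/-! ### The area of a convex quadrilateral -/

lemma lintegral_inv_sq {a b : ℝ} (ha : 0 < a) (hab : a ≤ b) :
    ∫⁻ y in Set.Icc a b, (((1 / ‖y‖₊) ^ 2 : NNReal) : ENNReal) =
      ENNReal.ofReal (1 / a - 1 / b) := by
  have hcont : ContinuousOn (fun y : ℝ => 1 / y ^ 2) (Set.Icc a b) :=
    continuousOn_const.div (by fun_prop) fun y hy => pow_ne_zero _ (ha.trans_le hy.1).ne'
  have hderiv : ∀ y ∈ Set.uIcc a b, HasDerivAt (fun y : ℝ => -(1 / y)) (1 / y ^ 2) y := by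
    intro y hy
    rw [Set.uIcc_of_le hab] at hy
    have hy0 : y ≠ 0 := (ha.trans_le hy.1).ne'
    simpa [one_div] using (hasDerivAt_inv hy0).fun_neg
  have hint : ∫ y in Set.Icc a b, 1 / y ^ 2 = 1 / a - 1 / b := by
    rw [integral_Icc_eq_integral_Ioc, ← intervalIntegral.integral_of_le hab,
      intervalIntegral.integral_eq_sub_of_hasDerivAt hderiv]
    · ring
    · exact ContinuousOn.intervalIntegrable (by rwa [Set.uIcc_of_le hab])
  rw [← hint, ofReal_integral_eq_lintegral_ofReal hcont.integrableOn_Icc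
    (Filter.Eventually.of_forall fun y => by positivity)]
  refine lintegral_congr fun y => ?_
  rw [← ENNReal.ofReal_coe_nnreal]
  congr 1
  simp [sq_abs]

/-- The hyperbolic area between two positive graphs. -/
lemma volume_between_graphs {u v : ℝ} (huv : u ≤ v) {f g : ℝ → ℝ} (hf : Continuous f)
    (hg : Continuous g) (hf0 : ∀ x ∈ Set.Icc u v, 0 < f x) (hfg : ∀ x ∈ Set.Icc u v, f x ≤ g x) :
    (volume : Measure ℍ).real {U | U.re ∈ Set.Icc u v ∧ U.im ∈ Set.Icc (f U.re) (g U.re)} =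
      ∫ x in u..v, (1 / f x - 1 / g x) := by
  set h : ℝ → ENNReal := fun y => (((1 / ‖y‖₊) ^ 2 : NNReal) : ENNReal) with hh
  have hmeas : Measurable h := by fun_prop
  set T : Set (ℝ × ℝ) := {p | p.1 ∈ Set.Icc u v ∧ p.2 ∈ Set.Icc (f p.1) (g p.1)} with hT
  have hTm : MeasurableSet T := by
    refine IsClosed.measurableSet ?_
    refine (isClosed_Icc.preimage continuous_fst).inter
      ((isClosed_le (hf.comp continuous_fst) continuous_snd).inter
        (isClosed_le continuous_snd (hg.comp continuous_fst)))
  have himage : UpperHalfPlane.coe ''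
      {U | U.re ∈ Set.Icc u v ∧ U.im ∈ Set.Icc (f U.re) (g U.re)} =
      Complex.measurableEquivRealProd ⁻¹' T := by
    ext z
    constructor
    · rintro ⟨U, hU, rfl⟩
      exact hU
    · intro hz
      have hz' : z.re ∈ Set.Icc u v ∧ z.im ∈ Set.Icc (f z.re) (g z.re) := hz
      exact ⟨⟨z, (hf0 _ hz'.1).trans_le hz'.2.1⟩, hz', rfl⟩
  have hvol : (volume : Measure ℍ) {U | U.re ∈ Set.Icc u v ∧ U.im ∈ Set.Icc (f U.re) (g U.re)} =
      ∫⁻ x in Set.Icc u v, ENNReal.ofReal (1 / f x - 1 / g x) := by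
    rw [volume_eq_lintegral, himage]
    have := Complex.volume_preserving_equiv_real_prod.setLIntegral_comp_emb
      Complex.measurableEquivRealProd.measurableEmbedding (fun p : ℝ × ℝ => h p.2)
        (Complex.measurableEquivRealProd ⁻¹' T)
    rw [Set.image_preimage_eq _ Complex.measurableEquivRealProd.surjective] at this
    refine Eq.trans ?_ (this.trans ?_)
    · rfl
    have hmeas' : Measurable fun p : ℝ × ℝ => h p.2 := hmeas.comp measurable_snd
    rw [← lintegral_indicator hTm, Measure.volume_eq_prod, lintegral_prod _
      (hmeas'.indicator hTm).aemeasurable, ← lintegral_indicator measurableSet_Icc]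
    refine lintegral_congr fun x => ?_
    by_cases hx : x ∈ Set.Icc u v
    · rw [Set.indicator_of_mem hx, ← lintegral_inv_sq (hf0 x hx) (hfg x hx),
        ← lintegral_indicator measurableSet_Icc]
      refine lintegral_congr fun y => ?_
      simp only [Set.indicator, hT, Set.mem_ofPred_eq, hx, true_and, hh]
    · rw [Set.indicator_of_notMem hx]
      simp only [Set.indicator, hT, Set.mem_ofPred_eq, hx, false_and, if_false, lintegral_zero]
  have hint : IntegrableOn (fun x => 1 / f x - 1 / g x) (Set.Icc u v) :=
    ContinuousOn.integrableOn_Icc <|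
      (continuousOn_const.div hf.continuousOn fun x hx => (hf0 x hx).ne').sub
        (continuousOn_const.div hg.continuousOn fun x hx => ((hf0 x hx).trans_le (hfg x hx)).ne')
  have hnn : 0 ≤ᵐ[volume.restrict (Set.Icc u v)] fun x => 1 / f x - 1 / g x := by
    refine (ae_restrict_iff' measurableSet_Icc).2 (Filter.Eventually.of_forall fun x hx => ?_)
    exact sub_nonneg.2 (one_div_le_one_div_of_le (hf0 x hx) (hfg x hx))
  rw [measureReal_def, hvol, ← ofReal_integral_eq_lintegral_ofReal hint hnn,
    ENNReal.toReal_ofReal (integral_nonneg_of_ae hnn), intervalIntegral.integral_of_le huv,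
    integral_Icc_eq_integral_Ioc]

/-- A geodesic arc lies in the upper half-plane when its endpoints `(0, p)` and `(v, Y)` do. -/
lemma arc_pos {p m v Y x : ℝ} (hp : 0 < p) (hY : 0 < Y) (h : p ^ 2 + m * v - v ^ 2 = Y ^ 2)
    (hx : x ∈ Set.uIcc 0 v) : 0 < p ^ 2 + m * x - x ^ 2 := by
  rw [← segment_eq_uIcc] at hx
  obtain ⟨s, t, hs, ht, hst, rfl⟩ := hx
  simp only [smul_eq_mul, mul_zero, zero_add]
  have e : p ^ 2 + m * (t * v) - (t * v) ^ 2 = s * p ^ 2 + t * Y ^ 2 + s * t * v ^ 2 := by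
    rw [← h, eq_sub_of_add_eq hst]; ring
  rw [e]
  rcases hs.eq_or_lt with rfl | hs
  · have : t = 1 := by linarith
    subst this; simp; positivity
  · positivity

/-- The integral of `dx / y` along the geodesic `x² + y² = p² + m x` from its point `(0, p)`. It is
twice the angle under which the arc is seen from the reflection of `(0, p)` in the real axis. -/
lemma integral_inv_sqrt {p m v : ℝ} (hp : 0 < p)
    (hpos : ∀ x ∈ Set.uIcc 0 v, 0 < p ^ 2 + m * x - x ^ 2) :
    IntervalIntegrable (fun x => 1 / √(p ^ 2 + m * x - x ^ 2)) volume 0 v ∧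
    ∫ x in 0..v, 1 / √(p ^ 2 + m * x - x ^ 2) =
      2 * Real.arctan (v / (√(p ^ 2 + m * v - v ^ 2) + p)) := by
  have hderiv : ∀ x ∈ Set.uIcc 0 v, HasDerivAt
      (fun x => 2 * Real.arctan (x / (√(p ^ 2 + m * x - x ^ 2) + p)))
      (1 / √(p ^ 2 + m * x - x ^ 2)) x := by
    intro x hx
    have hG := hpos x hx
    have h1 : HasDerivAt (fun x : ℝ => p ^ 2 + m * x - x ^ 2) (m * 1 - 2 * x) x := by
      simpa using (((hasDerivAt_id' x).const_mul m).const_add (p ^ 2)).fun_sub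
        ((hasDerivAt_id' x).fun_pow 2)
    have h2 := (h1.sqrt hG.ne').add_const p
    have hy : 0 < √(p ^ 2 + m * x - x ^ 2) := Real.sqrt_pos.2 hG
    have hy2 : √(p ^ 2 + m * x - x ^ 2) ^ 2 = p ^ 2 + m * x - x ^ 2 := Real.sq_sqrt hG.le
    have h3 := (((hasDerivAt_id' x).fun_div h2 (by positivity)).arctan).const_mul 2
    refine h3.congr_deriv ?_
    generalize √(p ^ 2 + m * x - x ^ 2) = y at *
    have : 0 < (y + p) ^ 2 + x ^ 2 := by positivity
    field_simp
    linear_combination hy2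
  have hint : IntervalIntegrable (fun x => 1 / √(p ^ 2 + m * x - x ^ 2)) volume 0 v := by
    refine ContinuousOn.intervalIntegrable ?_
    exact continuousOn_const.div (by fun_prop) fun x hx => (Real.sqrt_pos.2 (hpos x hx)).ne'
  refine ⟨hint, ?_⟩
  rw [intervalIntegral.integral_eq_sub_of_hasDerivAt hderiv hint]
  simp

/-- Half the integral of `dx / y` along the geodesic from `P` to `Q`; it is the sum of these over
the sides that, by Green's theorem, is half the area of a polygon. -/
noncomputable def sideAngle (P Q : ℍ) : ℝ := Real.arctan ((Q.re - P.re) / (P.im + Q.im))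

/-- Up to sign, the hyperbolic area of the triangle with vertices `(0, p)`, `(v, Y)`, `(0, q)`. -/
lemma integral_triangle {p q m n v Y : ℝ} (hp : 0 < p) (hq : 0 < q) (hY : 0 < Y)
    (hm : p ^ 2 + m * v - v ^ 2 = Y ^ 2) (hn : q ^ 2 + n * v - v ^ 2 = Y ^ 2) :
    ∫ x in 0..v, (1 / √(p ^ 2 + m * x - x ^ 2) - 1 / √(q ^ 2 + n * x - x ^ 2)) =
      2 * Real.arctan (v / (Y + p)) - 2 * Real.arctan (v / (Y + q)) := by
  obtain ⟨h1, h2⟩ := integral_inv_sqrt hp fun x hx => arc_pos hp hY hm hx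
  obtain ⟨h3, h4⟩ := integral_inv_sqrt hq fun x hx => arc_pos hq hY hn hx
  rw [intervalIntegral.integral_sub h1 h3, h2, h4, hm, hn, Real.sqrt_sq hY.le]

/-- The area in normal position: `A` and `C` on the imaginary axis, `A` below `C`, `B` on the right
and `D` on the left. -/
lemma IsConvexQuad.area_of_normal {A B C D : ℍ} (h : IsConvexQuad A B C D) (hA : A.re = 0)
    (hC : C.re = 0) (hAC : A.im < C.im) (hB : 0 < B.re) (hD : D.re < 0) :
    area A B C D = 2 * (sideAngle A B + sideAngle B C + sideAngle C D + sideAngle D A) := by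
  have hp := A.im_pos
  have hq := C.im_pos
  have hBi := B.im_pos
  have hDi := D.im_pos
  have hpq : A.im ^ 2 < C.im ^ 2 := by gcongr
  have hsq := sub_pos.2 hpq
  -- The slopes in the equations `x² + y² = p² + m x` of the lines of the four sides.
  obtain ⟨m₁, hm₁⟩ : ∃ m, m * B.re = B.re ^ 2 + B.im ^ 2 - A.im ^ 2 := ⟨_, div_mul_cancel₀ _ hB.ne'⟩
  obtain ⟨m₂, hm₂⟩ : ∃ m, m * B.re = B.re ^ 2 + B.im ^ 2 - C.im ^ 2 := ⟨_, div_mul_cancel₀ _ hB.ne'⟩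
  obtain ⟨m₃, hm₃⟩ : ∃ m, m * D.re = D.re ^ 2 + D.im ^ 2 - C.im ^ 2 := ⟨_, div_mul_cancel₀ _ hD.ne⟩
  obtain ⟨m₄, hm₄⟩ : ∃ m, m * D.re = D.re ^ 2 + D.im ^ 2 - A.im ^ 2 := ⟨_, div_mul_cancel₀ _ hD.ne⟩
  have sAB : ∀ U : ℍ, side A B U = B.re * (U.re ^ 2 + U.im ^ 2 - (A.im ^ 2 + m₁ * U.re)) := by
    intro U
    rw [side_eq, hA]
    linear_combination U.re * hm₁
  have sBC : ∀ U : ℍ, side B C U = B.re * (C.im ^ 2 + m₂ * U.re - (U.re ^ 2 + U.im ^ 2)) := by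
    intro U
    rw [side_eq, hC]
    linear_combination -U.re * hm₂
  have sCD : ∀ U : ℍ, side C D U = -D.re * (C.im ^ 2 + m₃ * U.re - (U.re ^ 2 + U.im ^ 2)) := by
    intro U
    rw [side_eq, hC]
    linear_combination U.re * hm₃
  have sDA : ∀ U : ℍ, side D A U = -D.re * (U.re ^ 2 + U.im ^ 2 - (A.im ^ 2 + m₄ * U.re)) := by
    intro U
    rw [side_eq, hA]
    linear_combination -U.re * hm₄
  have pABC : 0 < side A B C := by
    rw [sAB, hC]
    refine mul_pos hB ?_
    linarith
  have pCDA : 0 < side C D A := by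
    rw [sCD, hA]
    refine mul_pos (neg_pos.2 hD) ?_
    linarith
  have pBCD : 0 < side B C D := by
    have := h.sideBC
    rw [SameSide, side_cycle A B C] at this
    exact pos_of_mul_pos_left this pABC.le
  have pDAB : 0 < side D A B := by
    have := h.sideDA
    rw [SameSide, side_cycle C D A] at this
    exact pos_of_mul_pos_left this pCDA.le
  have h23 : m₂ < m₃ := by
    rw [sBC] at pBCD
    have := pos_of_mul_pos_right pBCD hB.le
    nlinarith
  have h41 : m₄ < m₁ := by
    rw [sDA] at pDAB
    have := pos_of_mul_pos_right pDAB (neg_pos.2 hD).le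
    nlinarith
  have hm₁' : A.im ^ 2 + m₁ * B.re - B.re ^ 2 = B.im ^ 2 := by rw [hm₁]; ring
  have hm₂' : C.im ^ 2 + m₂ * B.re - B.re ^ 2 = B.im ^ 2 := by rw [hm₂]; ring
  have hm₃' : C.im ^ 2 + m₃ * D.re - D.re ^ 2 = D.im ^ 2 := by rw [hm₃]; ring
  have hm₄' : A.im ^ 2 + m₄ * D.re - D.re ^ 2 = D.im ^ 2 := by rw [hm₄]; ring
  set f : ℝ → ℝ := fun x => √(A.im ^ 2 + max (m₁ * x) (m₄ * x) - x ^ 2) with hf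
  set g : ℝ → ℝ := fun x => √(C.im ^ 2 + min (m₂ * x) (m₃ * x) - x ^ 2) with hg
  have hf_right : ∀ x, 0 ≤ x → f x = √(A.im ^ 2 + m₁ * x - x ^ 2) := fun x hx => by
    simp only [hf]; rw [max_eq_left (by gcongr)]
  have hf_left : ∀ x, x ≤ 0 → f x = √(A.im ^ 2 + m₄ * x - x ^ 2) := fun x hx => by
    simp only [hf]; rw [max_eq_right (mul_le_mul_of_nonpos_right h41.le hx)]
  have hg_right : ∀ x, 0 ≤ x → g x = √(C.im ^ 2 + m₂ * x - x ^ 2) := fun x hx => by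
    simp only [hg]; rw [min_eq_left (by gcongr)]
  have hg_left : ∀ x, x ≤ 0 → g x = √(C.im ^ 2 + m₃ * x - x ^ 2) := fun x hx => by
    simp only [hg]; rw [min_eq_right (mul_le_mul_of_nonpos_right h23.le hx)]
  have h12 : (m₁ - m₂) * B.re = C.im ^ 2 - A.im ^ 2 := by linarith
  have h43 : (m₄ - m₃) * D.re = C.im ^ 2 - A.im ^ 2 := by linarith
  have h12' : 0 < m₁ - m₂ := pos_of_mul_pos_left (h12 ▸ hsq) hB.le
  have h43' : m₄ - m₃ < 0 := by
    by_contra! hn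
    have := mul_nonpos_of_nonneg_of_nonpos hn hD.le
    linarith
  have hquad : quad A B C D =
      {U | U.re ∈ Set.Icc D.re B.re ∧ U.im ∈ Set.Icc (f U.re) (g U.re)} := by
    ext U
    have hU := U.im_pos
    simp only [quad, halfPlane, Set.mem_inter_iff, Set.mem_ofPred_eq, Set.mem_Icc,
      mul_nonneg_iff_of_pos_left pABC, mul_nonneg_iff_of_pos_left pBCD,
      mul_nonneg_iff_of_pos_left pCDA, mul_nonneg_iff_of_pos_left pDAB]
    simp only [sAB, sBC, sCD, sDA, mul_nonneg_iff_of_pos_left hB,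
      mul_nonneg_iff_of_pos_left (neg_pos.2 hD), hf, hg,
      Real.sqrt_le_left hU.le, Real.le_sqrt' hU]
    constructor
    · rintro ⟨⟨⟨h1, h2⟩, h3⟩, h4⟩
      refine ⟨⟨?_, ?_⟩, ?_, ?_⟩
      · by_contra! hn
        have := mul_lt_mul_of_neg_left hn h43'
        linarith
      · by_contra! hn
        have := mul_lt_mul_of_pos_left hn h12'
        linarith
      · have := max_le (show m₁ * U.re ≤ U.re ^ 2 + U.im ^ 2 - A.im ^ 2 by linarith)
          (show m₄ * U.re ≤ U.re ^ 2 + U.im ^ 2 - A.im ^ 2 by linarith)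
        linarith
      · have := le_min (show U.re ^ 2 + U.im ^ 2 - C.im ^ 2 ≤ m₂ * U.re by linarith)
          (show U.re ^ 2 + U.im ^ 2 - C.im ^ 2 ≤ m₃ * U.re by linarith)
        linarith
    · rintro ⟨-, h1, h2⟩
      have := le_max_left (m₁ * U.re) (m₄ * U.re)
      have := le_max_right (m₁ * U.re) (m₄ * U.re)
      have := min_le_left (m₂ * U.re) (m₃ * U.re)
      have := min_le_right (m₂ * U.re) (m₃ * U.re)
      exact ⟨⟨⟨by linarith, by linarith⟩, by linarith⟩, by linarith⟩
  have hfc : Continuous f := by fun_prop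
  have hgc : Continuous g := by fun_prop
  have hf0 : ∀ x ∈ Set.Icc D.re B.re, 0 < f x := by
    intro x hx
    rcases le_total 0 x with h0 | h0
    · rw [hf_right x h0]
      exact Real.sqrt_pos.2 (arc_pos hp hBi hm₁' (Set.mem_uIcc.2 (.inl ⟨h0, hx.2⟩)))
    · rw [hf_left x h0]
      exact Real.sqrt_pos.2 (arc_pos hp hDi hm₄' (Set.mem_uIcc.2 (.inr ⟨hx.1, h0⟩)))
  have hfg : ∀ x ∈ Set.Icc D.re B.re, f x ≤ g x := by
    intro x hx
    rcases le_total 0 x with h0 | h0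
    · rw [hf_right x h0, hg_right x h0]
      refine Real.sqrt_le_sqrt ?_
      have := mul_le_mul_of_nonneg_left hx.2 h12'.le
      linarith
    · rw [hf_left x h0, hg_left x h0]
      refine Real.sqrt_le_sqrt ?_
      have := mul_le_mul_of_nonpos_left hx.1 h43'.le
      linarith
  have hF : ∀ u v, u ∈ Set.Icc D.re B.re → v ∈ Set.Icc D.re B.re →
      IntervalIntegrable (fun x => 1 / f x - 1 / g x) volume u v := by
    intro u v hu hv
    refine ContinuousOn.intervalIntegrable (ContinuousOn.mono ?_ (Set.uIcc_subset_Icc hu hv))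
    exact (continuousOn_const.div hfc.continuousOn fun x hx => (hf0 x hx).ne').sub
      (continuousOn_const.div hgc.continuousOn fun x hx => ((hf0 x hx).trans_le (hfg x hx)).ne')
  have h0 : (0 : ℝ) ∈ Set.Icc D.re B.re := ⟨hD.le, hB.le⟩
  rw [area, hquad, volume_between_graphs (hD.trans hB).le hfc hgc hf0 hfg,
    ← intervalIntegral.integral_add_adjacent_intervals
      (hF _ _ ⟨le_rfl, (hD.trans hB).le⟩ h0) (hF _ _ h0 ⟨(hD.trans hB).le, le_rfl⟩),
    intervalIntegral.integral_symm]
  have e1 : ∫ x in 0..B.re, (1 / f x - 1 / g x) =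
      2 * Real.arctan (B.re / (B.im + A.im)) - 2 * Real.arctan (B.re / (B.im + C.im)) := by
    rw [← integral_triangle hp hq hBi hm₁' hm₂']
    refine intervalIntegral.integral_congr fun x hx => ?_
    rw [Set.uIcc_of_le hB.le] at hx
    simp only [hf_right x hx.1, hg_right x hx.1]
  have e2 : ∫ x in 0..D.re, (1 / f x - 1 / g x) =
      2 * Real.arctan (D.re / (D.im + A.im)) - 2 * Real.arctan (D.re / (D.im + C.im)) := by
    rw [← integral_triangle hp hq hDi hm₄' hm₃']
    refine intervalIntegral.integral_congr fun x hx => ?_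
    rw [Set.uIcc_of_ge hD.le] at hx
    simp only [hf_left x hx.2, hg_left x hx.2]
  rw [e1, e2]
  simp only [sideAngle, hA, hC, sub_zero, zero_sub, neg_div, Real.arctan_neg]
  rw [add_comm A.im B.im, add_comm C.im D.im]
  ring

lemma IsConvexQuad.area_pos_of_normal {A B C D : ℍ} (h : IsConvexQuad A B C D) (hA : A.re = 0)
    (hC : C.re = 0) (hAC : A.im < C.im) (hB : 0 < B.re) (hD : D.re < 0) : 0 < area A B C D := by
  have hp := A.im_pos
  have hq := C.im_pos
  have hBi := B.im_pos
  have hDi := D.im_pos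
  rw [h.area_of_normal hA hC hAC hB hD]
  simp only [sideAngle, hA, hC, sub_zero, zero_sub]
  have h1 : Real.arctan (-B.re / (B.im + C.im)) > Real.arctan (-(B.re / (A.im + B.im))) := by
    refine Real.arctan_strictMono ?_
    rw [neg_div, neg_lt_neg_iff]
    exact div_lt_div_of_pos_left hB (by positivity) (by linarith)
  have h2 : Real.arctan (D.re / (C.im + D.im)) > Real.arctan (-(-D.re / (D.im + A.im))) := by
    refine Real.arctan_strictMono ?_
    rw [← neg_div, neg_neg, ← neg_lt_neg_iff, ← neg_div, ← neg_div]
    exact div_lt_div_of_pos_left (neg_pos.2 hD) (by positivity) (by linarith)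
  rw [Real.arctan_neg] at h1 h2
  linarith

/-! ### The area in terms of sides and diagonals -/

lemma four_mul_sinh_half_dist_sq (P Q : ℍ) : 4 * (P.im * Q.im) * Real.sinh (dist P Q / 2) ^ 2 =
    (Q.re - P.re) ^ 2 + (Q.im - P.im) ^ 2 := by
  have hP := P.im_pos
  have hQ := Q.im_pos
  rw [sinh_half_dist, div_pow, mul_pow, Real.sq_sqrt (by positivity), Complex.dist_eq,
    Complex.sq_norm, Complex.normSq_apply]
  simp only [Complex.sub_re, Complex.sub_im, coe_re, coe_im]
  field_simp
  ring

/-- The vector `(P.im + Q.im, Q.re - P.re)`, of which `sideAngle P Q` is the argument, has length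
`2 √(P.im * Q.im) * cosh (dist P Q / 2)`. -/
lemma cos_sin_sideAngle (P Q : ℍ) :
    Real.cos (sideAngle P Q) * (2 * (√P.im * √Q.im) * Real.cosh (dist P Q / 2)) = P.im + Q.im ∧
    Real.sin (sideAngle P Q) * (2 * (√P.im * √Q.im) * Real.cosh (dist P Q / 2)) =
      Q.re - P.re := by
  have hP := P.im_pos
  have hQ := Q.im_pos
  set R := 2 * (√P.im * √Q.im) * Real.cosh (dist P Q / 2) with hR
  have hR0 : 0 < R := by
    have := Real.cosh_pos (dist P Q / 2)
    have := Real.sqrt_pos.2 hP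
    have := Real.sqrt_pos.2 hQ
    positivity
  have hR2 : R ^ 2 = (Q.re - P.re) ^ 2 + (P.im + Q.im) ^ 2 := by
    have := four_mul_sinh_half_dist_sq P Q
    rw [hR, mul_pow, mul_pow, mul_pow, Real.sq_sqrt hP.le, Real.sq_sqrt hQ.le, Real.cosh_sq]
    linear_combination this
  have hs : √(1 + ((Q.re - P.re) / (P.im + Q.im)) ^ 2) = R / (P.im + Q.im) := by
    rw [Real.sqrt_eq_iff_mul_self_eq (by positivity) (by positivity), ← sq, div_pow, div_pow, hR2]
    field_simp
    ring
  rw [sideAngle, Real.cos_arctan, Real.sin_arctan, hs]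
  constructor <;> field_simp

/-- The right-hand side below is symmetric under the dihedral group of the quadrilateral, and the
identity holds for any four points. -/
lemma cos_sum_sideAngle (A B C D : ℍ) :
    Real.cos (sideAngle A B + sideAngle B C + sideAngle C D + sideAngle D A) *
      (Real.cosh (dist A B / 2) * Real.cosh (dist B C / 2) * Real.cosh (dist C D / 2) *
        Real.cosh (dist D A / 2)) =
    1 + (Real.sinh (dist A B / 2) ^ 2 + Real.sinh (dist B C / 2) ^ 2 +
        Real.sinh (dist C D / 2) ^ 2 + Real.sinh (dist D A / 2) ^ 2) / 2 +
      ((Real.sinh (dist A B / 2) * Real.sinh (dist C D / 2)) ^ 2 +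
        (Real.sinh (dist B C / 2) * Real.sinh (dist D A / 2)) ^ 2 -
        (Real.sinh (dist A C / 2) * Real.sinh (dist B D / 2)) ^ 2) / 2 := by
  have hA := A.im_pos
  have hB := B.im_pos
  have hC := C.im_pos
  have hD := D.im_pos
  obtain ⟨c1, s1⟩ := cos_sin_sideAngle A B
  obtain ⟨c2, s2⟩ := cos_sin_sideAngle B C
  obtain ⟨c3, s3⟩ := cos_sin_sideAngle C D
  obtain ⟨c4, s4⟩ := cos_sin_sideAngle D A
  have hprod : (2 * (√A.im * √B.im) * Real.cosh (dist A B / 2)) *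
      (2 * (√B.im * √C.im) * Real.cosh (dist B C / 2)) *
      (2 * (√C.im * √D.im) * Real.cosh (dist C D / 2)) *
      (2 * (√D.im * √A.im) * Real.cosh (dist D A / 2)) =
      16 * (A.im * B.im * C.im * D.im) * (Real.cosh (dist A B / 2) * Real.cosh (dist B C / 2) *
        Real.cosh (dist C D / 2) * Real.cosh (dist D A / 2)) := by
    have eA := Real.sq_sqrt hA.le
    have eB := Real.sq_sqrt hB.le
    have eC := Real.sq_sqrt hC.le
    have eD := Real.sq_sqrt hD.le
    conv_rhs => rw [← eA, ← eB, ← eC, ← eD]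
    ring
  have hAB := four_mul_sinh_half_dist_sq A B
  have hBC := four_mul_sinh_half_dist_sq B C
  have hCD := four_mul_sinh_half_dist_sq C D
  have hDA := four_mul_sinh_half_dist_sq D A
  have hAC := four_mul_sinh_half_dist_sq A C
  have hBD := four_mul_sinh_half_dist_sq B D
  have h0 : 16 * (A.im * B.im * C.im * D.im) ≠ 0 := by positivity
  refine mul_left_cancel₀ h0 ?_
  rw [mul_left_comm, ← hprod]
  simp only [mul_pow, Real.cos_add, Real.sin_add]
  generalize 2 * (√A.im * √B.im) * Real.cosh (dist A B / 2) = R1 at *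
  generalize 2 * (√B.im * √C.im) * Real.cosh (dist B C / 2) = R2 at *
  generalize 2 * (√C.im * √D.im) * Real.cosh (dist C D / 2) = R3 at *
  generalize 2 * (√D.im * √A.im) * Real.cosh (dist D A / 2) = R4 at *
  generalize Real.cos (sideAngle A B) = x1, Real.cos (sideAngle B C) = x2,
    Real.cos (sideAngle C D) = x3, Real.cos (sideAngle D A) = x4 at *
  generalize Real.sin (sideAngle A B) = y1, Real.sin (sideAngle B C) = y2,
    Real.sin (sideAngle C D) = y3, Real.sin (sideAngle D A) = y4 at *
  generalize Real.sinh (dist A B / 2) ^ 2 = k1, Real.sinh (dist B C / 2) ^ 2 = k2,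
    Real.sinh (dist C D / 2) ^ 2 = k3, Real.sinh (dist D A / 2) ^ 2 = k4,
    Real.sinh (dist A C / 2) ^ 2 = k5, Real.sinh (dist B D / 2) ^ 2 = k6 at *
  have e1 : (((x1 * x2 - y1 * y2) * x3 - (y1 * x2 + x1 * y2) * y3) * x4 -
      ((y1 * x2 + x1 * y2) * x3 + (x1 * x2 - y1 * y2) * y3) * y4) * (R1 * R2 * R3 * R4) =
      (((x1 * R1) * (x2 * R2) - (y1 * R1) * (y2 * R2)) * (x3 * R3) -
        ((y1 * R1) * (x2 * R2) + (x1 * R1) * (y2 * R2)) * (y3 * R3)) * (x4 * R4) -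
      (((y1 * R1) * (x2 * R2) + (x1 * R1) * (y2 * R2)) * (x3 * R3) +
        ((x1 * R1) * (x2 * R2) - (y1 * R1) * (y2 * R2)) * (y3 * R3)) * (y4 * R4) := by ring
  have e2 : 16 * (A.im * B.im * C.im * D.im) *
      (1 + (k1 + k2 + k3 + k4) / 2 + (k1 * k3 + k2 * k4 - k5 * k6) / 2) =
      16 * (A.im * B.im * C.im * D.im) +
      2 * (C.im * D.im * (4 * (A.im * B.im) * k1) + D.im * A.im * (4 * (B.im * C.im) * k2) +
        A.im * B.im * (4 * (C.im * D.im) * k3) + B.im * C.im * (4 * (D.im * A.im) * k4)) +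
      ((4 * (A.im * B.im) * k1) * (4 * (C.im * D.im) * k3) +
        (4 * (B.im * C.im) * k2) * (4 * (D.im * A.im) * k4) -
        (4 * (A.im * C.im) * k5) * (4 * (B.im * D.im) * k6)) / 2 := by ring
  rw [e1, e2, c1, c2, c3, c4, s1, s2, s3, s4, hAB, hBC, hCD, hDA, hAC, hBD]
  ring

/-- The area of `ABCD` lies between `0` and `4π`, and the cosine of its half is given by the sides
and diagonals. -/
structure HasAreaFormula (A B C D : ℍ) : Prop where
  area_pos : 0 < area A B C D
  area_lt : area A B C D < 4 * Real.pi
  cos_half_area : Real.cos (area A B C D / 2) *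
      (Real.cosh (dist A B / 2) * Real.cosh (dist B C / 2) * Real.cosh (dist C D / 2) *
        Real.cosh (dist D A / 2)) =
    1 + (Real.sinh (dist A B / 2) ^ 2 + Real.sinh (dist B C / 2) ^ 2 +
        Real.sinh (dist C D / 2) ^ 2 + Real.sinh (dist D A / 2) ^ 2) / 2 +
      ((Real.sinh (dist A B / 2) * Real.sinh (dist C D / 2)) ^ 2 +
        (Real.sinh (dist B C / 2) * Real.sinh (dist D A / 2)) ^ 2 -
        (Real.sinh (dist A C / 2) * Real.sinh (dist B D / 2)) ^ 2) / 2

lemma HasAreaFormula.of_smul {A B C D : ℍ} (g : Matrix.SpecialLinearGroup (Fin 2) ℝ)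
    (h : HasAreaFormula (g • A) (g • B) (g • C) (g • D)) : HasAreaFormula A B C D := by
  obtain ⟨h1, h2, h3⟩ := h
  simp only [area_smul, dist_smul] at h1 h2 h3
  exact ⟨h1, h2, h3⟩

lemma HasAreaFormula.rotate {A B C D : ℍ} (h : HasAreaFormula A B C D) :
    HasAreaFormula B C D A := by
  obtain ⟨h1, h2, h3⟩ := h
  rw [← area_rotate] at h1 h2 h3
  refine ⟨h1, h2, ?_⟩
  rw [dist_comm C A]
  linear_combination h3

lemma HasAreaFormula.reverse {A B C D : ℍ} (hQ : IsConvexQuad A B C D)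
    (h : HasAreaFormula A B C D) : HasAreaFormula A D C B := by
  obtain ⟨h1, h2, h3⟩ := h
  rw [← hQ.area_reverse] at h1 h2 h3
  refine ⟨h1, h2, ?_⟩
  rw [dist_comm A D, dist_comm D C, dist_comm C B, dist_comm B A, dist_comm D B]
  linear_combination h3

lemma IsConvexQuad.hasAreaFormula_of_normal {A B C D : ℍ} (h : IsConvexQuad A B C D)
    (hA : A.re = 0) (hC : C.re = 0) (hAC : A.im < C.im) (hB : 0 < B.re) (hD : D.re < 0) :
    HasAreaFormula A B C D := by
  have e := h.area_of_normal hA hC hAC hB hD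
  refine ⟨h.area_pos_of_normal hA hC hAC hB hD, ?_, ?_⟩
  · have hlt : ∀ P Q, sideAngle P Q < Real.pi / 2 := fun P Q => Real.arctan_lt_pi_div_two _
    linarith [hlt A B, hlt B C, hlt C D, hlt D A]
  · rw [e, mul_div_cancel_left₀ _ two_ne_zero, cos_sum_sideAngle]

theorem IsConvexQuad.hasAreaFormula {A B C D : ℍ} (h : IsConvexQuad A B C D) :
    HasAreaFormula A B C D := by
  obtain ⟨g, hA, hC⟩ := exists_smul_re_eq_zero A C
  refine HasAreaFormula.of_smul g ?_
  replace h := h.smul g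
  generalize g • A = A, g • B = B, g • C = C, g • D = D at *
  -- The diagonal `AC` separates `B` from `D`. Renaming the vertices gives the normal position.
  have hs := h.side_mul_side_pos
  simp only [side_eq, hA, hC] at hs
  have hp := A.im_pos
  have hq := C.im_pos
  have h1 : 0 < (C.im ^ 2 - A.im ^ 2) ^ 2 * -(B.re * D.re) := by
    refine hs.trans_eq ?_
    ring
  have h2 : B.re * D.re < 0 := by
    have := pos_of_mul_pos_right h1 (sq_nonneg _)
    linarith
  have h3 : A.im ≠ C.im := by
    intro h; simp [h] at h1
  rcases h3.lt_or_gt with hAC | hAC <;> rcases mul_neg_iff.1 h2 with ⟨hB, hD⟩ | ⟨hB, hD⟩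
  · exact h.hasAreaFormula_of_normal hA hC hAC hB hD
  · exact (h.reverse.hasAreaFormula_of_normal hA hC hAC hD hB).reverse h.reverse
  · have h' := h.reverse.rotate.rotate
    exact ((h'.hasAreaFormula_of_normal hC hA hAC hB hD).rotate.rotate).reverse h.reverse
  · exact (h.rotate.rotate.hasAreaFormula_of_normal hC hA hAC hD hB).rotate.rotate

/-! ### The two inequalities -/

lemma cosh_mul_cosh_eq (x y : ℝ) :
    Real.cosh x * Real.cosh y = (Real.cosh (x + y) + Real.cosh (x - y)) / 2 := by
  rw [Real.cosh_add, Real.cosh_sub]; ring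

lemma sinh_mul_sinh_eq (x y : ℝ) :
    Real.sinh x * Real.sinh y = (Real.cosh (x + y) - Real.cosh (x - y)) / 2 := by
  rw [Real.cosh_add, Real.cosh_sub]; ring

/-- Brahmagupta's formula in the forms `tan² (S / 4) = N / (M - σ)` and
`sin² (S / 2) = 4 N (M - σ) / K²`, where `N`, `M` are the products of the `sinh` and `cosh` of
`(s - a) / 2`, …, and `σ`, `K` those of `a / 2`, …. The inequalities follow from `0 < N`
and `0 < σ < M`. -/
lemma brahmagupta_inequalities {a b c d s S : ℝ} (ha : 0 < a) (hb : 0 < b) (hc : 0 < c)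
    (hd : 0 < d) (hs : s = (a + b + c + d) / 2) (hS : 0 < S) (hS' : S < 4 * Real.pi)
    (hcos : Real.cos (S / 2) *
      (Real.cosh (a / 2) * Real.cosh (b / 2) * Real.cosh (c / 2) * Real.cosh (d / 2)) =
      1 + (Real.sinh (a / 2) ^ 2 + Real.sinh (b / 2) ^ 2 + Real.sinh (c / 2) ^ 2 +
        Real.sinh (d / 2) ^ 2) / 2 -
        Real.sinh (a / 2) * Real.sinh (b / 2) * Real.sinh (c / 2) * Real.sinh (d / 2)) :
    Real.sin (S / 2) ^ 2 <
        (Real.sinh (s - a) * Real.sinh (s - b) * Real.sinh (s - c) * Real.sinh (s - d)) /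
          (4 * (Real.cosh (a / 2) ^ 2 * Real.cosh (b / 2) ^ 2 *
            Real.cosh (c / 2) ^ 2 * Real.cosh (d / 2) ^ 2)) ∧
      Real.tanh ((s - a) / 2) * Real.tanh ((s - b) / 2) *
          Real.tanh ((s - c) / 2) * Real.tanh ((s - d) / 2) <
        Real.tan (S / 4) ^ 2 := by
  set K := Real.cosh (a / 2) * Real.cosh (b / 2) * Real.cosh (c / 2) * Real.cosh (d / 2) with hK
  set σ := Real.sinh (a / 2) * Real.sinh (b / 2) * Real.sinh (c / 2) * Real.sinh (d / 2) with hσ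
  set M := Real.cosh ((s - a) / 2) * Real.cosh ((s - b) / 2) * Real.cosh ((s - c) / 2) *
    Real.cosh ((s - d) / 2) with hM
  set N := Real.sinh ((s - a) / 2) * Real.sinh ((s - b) / 2) * Real.sinh ((s - c) / 2) *
    Real.sinh ((s - d) / 2) with hN
  have hab : (s - a) / 2 + (s - b) / 2 = c / 2 + d / 2 := by rw [hs]; ring
  have hab' : (s - a) / 2 - (s - b) / 2 = b / 2 - a / 2 := by ring
  have hcd : (s - c) / 2 + (s - d) / 2 = a / 2 + b / 2 := by rw [hs]; ring
  have hcd' : (s - c) / 2 - (s - d) / 2 = d / 2 - c / 2 := by ring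
  have cab := cosh_mul_cosh_eq ((s - a) / 2) ((s - b) / 2)
  have ccd := cosh_mul_cosh_eq ((s - c) / 2) ((s - d) / 2)
  have sab := sinh_mul_sinh_eq ((s - a) / 2) ((s - b) / 2)
  have scd := sinh_mul_sinh_eq ((s - c) / 2) ((s - d) / 2)
  rw [hab, hab', Real.cosh_add, Real.cosh_sub] at cab sab
  rw [hcd, hcd', Real.cosh_add, Real.cosh_sub] at ccd scd
  have hM' : M = (Real.cosh ((s - a) / 2) * Real.cosh ((s - b) / 2)) *
    (Real.cosh ((s - c) / 2) * Real.cosh ((s - d) / 2)) := by rw [hM]; ring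
  have hN' : N = (Real.sinh ((s - a) / 2) * Real.sinh ((s - b) / 2)) *
    (Real.sinh ((s - c) / 2) * Real.sinh ((s - d) / 2)) := by rw [hN]; ring
  have I1 : M + N = K + σ := by
    rw [hM', hN', cab, ccd, sab, scd, hK, hσ]; ring
  have I2 : M - N = 1 + (Real.sinh (a / 2) ^ 2 + Real.sinh (b / 2) ^ 2 + Real.sinh (c / 2) ^ 2 +
        Real.sinh (d / 2) ^ 2) / 2 := by
    have ea := Real.cosh_sq (a / 2)
    have eb := Real.cosh_sq (b / 2)
    have ec := Real.cosh_sq (c / 2)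
    have ed := Real.cosh_sq (d / 2)
    have e : M - N = ((Real.cosh (a / 2) ^ 2 * Real.cosh (b / 2) ^ 2 -
        Real.sinh (a / 2) ^ 2 * Real.sinh (b / 2) ^ 2) +
        (Real.cosh (c / 2) ^ 2 * Real.cosh (d / 2) ^ 2 -
        Real.sinh (c / 2) ^ 2 * Real.sinh (d / 2) ^ 2)) / 2 := by
      rw [hM', hN', cab, ccd, sab, scd]; ring
    rw [e, ea, eb, ec, ed]; ring
  have pa := Real.sinh_pos_iff.2 (half_pos ha)
  have pb := Real.sinh_pos_iff.2 (half_pos hb)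
  have pc := Real.sinh_pos_iff.2 (half_pos hc)
  have pd := Real.sinh_pos_iff.2 (half_pos hd)
  have hσ0 : 0 < σ := by positivity
  have hK0 : 0 < K := by
    have := Real.cosh_pos (a / 2)
    have := Real.cosh_pos (b / 2)
    have := Real.cosh_pos (c / 2)
    have := Real.cosh_pos (d / 2)
    positivity
  have hσM : σ < M := by
    have h1 := Real.cosh_pos (b / 2 - a / 2)
    have h2 := Real.cosh_pos (c / 2 - d / 2)
    have h3 := Real.cosh_pos (d / 2 - c / 2)
    have h4 := Real.cosh_pos (a / 2 - b / 2)
    rw [Real.cosh_sub] at h1 h2 h3 h4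
    have e1 : Real.sinh (c / 2) * Real.sinh (d / 2) <
        Real.cosh ((s - a) / 2) * Real.cosh ((s - b) / 2) := by
      rw [cab]; linarith
    have e2 : Real.sinh (a / 2) * Real.sinh (b / 2) <
        Real.cosh ((s - c) / 2) * Real.cosh ((s - d) / 2) := by
      rw [ccd]; linarith
    rw [hM']
    refine lt_of_eq_of_lt ?_ (mul_lt_mul'' e1 e2 (by positivity) (by positivity))
    rw [hσ]; ring
  have hcos1 : (1 - Real.cos (S / 2)) * K = 2 * N := by linear_combination I2 - I1 - hcos
  have hcos2 : (1 + Real.cos (S / 2)) * K = 2 * (M - σ) := by linear_combination hcos - I2 - I1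
  have hN0 : 0 < N := by
    -- The quarter area lies strictly between `0` and `π`.
    have hsin : 0 < Real.sin (S / 4) := Real.sin_pos_of_pos_of_lt_pi (by linarith) (by linarith)
    have : 0 < 1 - Real.cos (S / 2) := by
      rw [show S / 2 = 2 * (S / 4) by ring, Real.cos_two_mul, Real.cos_sq']
      have := pow_pos hsin 2
      linarith
    have := mul_pos this hK0
    linarith
  have hM0 : 0 < M := hσ0.trans hσM
  constructor
  · have e1 : Real.sinh (s - a) * Real.sinh (s - b) * Real.sinh (s - c) * Real.sinh (s - d) =
        16 * (N * M) := by
      have h2 : ∀ x : ℝ, Real.sinh (s - x) =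
          2 * Real.sinh ((s - x) / 2) * Real.cosh ((s - x) / 2) := fun x => by
        rw [← Real.sinh_two_mul]; congr 1; ring
      rw [h2, h2, h2, h2, hN, hM]; ring
    have e2 : 4 * (Real.cosh (a / 2) ^ 2 * Real.cosh (b / 2) ^ 2 *
            Real.cosh (c / 2) ^ 2 * Real.cosh (d / 2) ^ 2) = 4 * K ^ 2 := by rw [hK]; ring
    rw [e1, e2, lt_div_iff₀ (by positivity), Real.sin_sq]
    have e3 : (1 - Real.cos (S / 2) ^ 2) * (4 * K ^ 2) = 16 * (N * (M - σ)) := by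
      linear_combination 4 * (1 + Real.cos (S / 2)) * K * hcos1 + 8 * N * hcos2
    rw [e3]
    gcongr
    linarith
  · have e1 : Real.tan (S / 4) ^ 2 = N / (M - σ) := by
      have hMσ : 0 < M - σ := sub_pos.2 hσM
      rw [show S / 2 = 2 * (S / 4) by ring, Real.cos_two_mul] at hcos1 hcos2
      have h2 : Real.cos (S / 4) ^ 2 * K = M - σ := by linear_combination hcos2 / 2
      have hc0 : Real.cos (S / 4) ≠ 0 := by
        rintro h; rw [h] at h2; simp at h2; linarith
      rw [Real.tan_eq_sin_div_cos, div_pow, Real.sin_sq, div_eq_div_iff (by positivity) hMσ.ne']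
      have h3 : (1 - Real.cos (S / 4) ^ 2) * K = N := by linear_combination hcos1 / 2
      rw [← h2, ← h3]; ring
    have e2 : Real.tanh ((s - a) / 2) * Real.tanh ((s - b) / 2) *
          Real.tanh ((s - c) / 2) * Real.tanh ((s - d) / 2) = N / M := by
      simp only [Real.tanh_eq_sinh_div_cosh, div_mul_div_comm, hN, hM]
    rw [e1, e2]
    exact div_lt_div_of_pos_left hN0 (sub_pos.2 hσM) (by linarith)

end HypPlane

theorem mainTheorem10 (A B C D : ℍ) (hQ : HypPlane.IsCyclicQuad A B C D)
    (a b c d s S : ℝ)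
    (ha : a = dist A B) (hb : b = dist B C) (hc : c = dist C D) (hd : d = dist D A)
    (hs : s = (a + b + c + d) / 2) (hS : S = HypPlane.area A B C D) :
    Real.sin (S / 2) ^ 2 <
        (Real.sinh (s - a) * Real.sinh (s - b) * Real.sinh (s - c) * Real.sinh (s - d)) /
          (4 * (Real.cosh (a / 2) ^ 2 * Real.cosh (b / 2) ^ 2 *
            Real.cosh (c / 2) ^ 2 * Real.cosh (d / 2) ^ 2)) ∧
      Real.tanh ((s - a) / 2) * Real.tanh ((s - b) / 2) *
          Real.tanh ((s - c) / 2) * Real.tanh ((s - d) / 2) <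
        Real.tan (S / 4) ^ 2 := by
  obtain ⟨h1, h2, h3⟩ := hQ.1.hasAreaFormula
  have hP : Real.sinh (dist A C / 2) * Real.sinh (dist B D / 2) = _ := hQ.ptolemyEq
  rw [hP] at h3
  rw [← hS] at h1 h2 h3
  rw [← ha, ← hb, ← hc, ← hd] at h3
  exact HypPlane.brahmagupta_inequalities (ha ▸ dist_pos.2 hQ.1.ne)
    (hb ▸ dist_pos.2 hQ.1.rotate.ne) (hc ▸ dist_pos.2 hQ.1.rotate.rotate.ne)
    (hd ▸ dist_pos.2 hQ.1.rotate.rotate.rotate.ne) hs h1 h2 (by linear_combination h3)
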